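/- Let $C$ be a non-empty higher rank graph, that is, a countable category with a functor $d\colon C\to\mathbb{N}^k$ ($k\in\mathbb{N}$) having the unique factorization property: if $d(a)=\mathbf{m}+\mathbf{n}$ then there are unique arrows $a_1,a_2$ with $a=a_1a_2$, $d(a_1)=\mathbf{m}$ and $d(a_2)=\mathbf{n}$. (The product $ab$ of arrows is defined when the domain of $a$ equals the codomain of $b$; identities are identified with objects.) Suppose that $C$ has finitely many identities, has no sources (for every identity $e$ and $\mathbf{m}\in\mathbb{N}^k$ there is an arrow with codomain $e$ and degree $\mathbf{m}$), and is row finite (for every such $e$ and $\mathbf{m}$ there are only finitely many such arrows). A finitely generated right ideal of $C$ is a set $XC=\{xs : x\in X,\ s\in C,\ xs \text{ defined}\}$ with $X$ a finite, possibly empty, set of arrows. Let $\mathsf{R}(C)$ be the inverse monoid with zero, under composition of partial bijections, of all bijections $\theta\colon R_1\to R_2$ between finitely generated right ideals of $C$ such that $\theta(rs)=\theta(r)s$ whenever $r\in R_1$ and $rs$ is defined. Let $\leq$ denote the natural partial order of an inverse semigroup, $a\le b \Leftrightarrow a=ba^{-1}a$. The Lenz congruence $\equiv$ on $\mathsf{R}(C)$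 is defined by: $s\equiv t$ if and only if for each $0\ne x\le s$ there is $z\neq 0$ with $z\le x$ and $z\le t$, and for each $0\neq y\le t$ there is $z\ne0$ with $z\le y$ and $z\le s$. Put $\mathsf{B}(C)=\mathsf{R}(C)/{\equiv}$. A non-zero idempotent $e$ is essential if $ef\neq 0$ for every non-zero idempotent $f$. Let $\mathsf{R}(C)^e$ be the inverse semigroup of all $s\in\mathsf{R}(C)$ for which both $s^{-1}s$ and $ss^{-1}$ are essential (that is, the bijective morphisms between finitely generated essential right ideals), let $\sigma$ be its minimum group congruence ($s\mathrel{\sigma}t$ if and only if there is $z\in\mathsf{R}(C)^e$ with $z\le s,t$), and put $\mathscr{G}(C)=\mathsf{R}(C)^e/\sigma$. Then $\mathsf{B}(C)$ is a Boolean inverse monoid: it is an inverse monoid with zero in which any two compatible elements $a,b$ (meaning that $a^{-1}b$ and $ab^{-1}$ are idempotents) have a join with respect to $\le$, multiplication on either side distributes over such joins, and the idempotents form a Boolean algebra under $\leq$. Moreover, the group of units of $\mathsf{B}(C)$ is isomorphic to the group $\mathscr{G}(C)$. -/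

import Mathlib

open CategoryTheory

universe u v

/-! ### Inverse semigroups -/

/-- An inverse semigroup: every `a` has exactly one `b` with `a = aba` and `b = bab`;
this `b` is written `a⁻¹`. -/
class InverseSemigroup (S : Type u) extends Semigroup S, Inv S where
  mul_inv_mul (a : S) : a * a⁻¹ * a = a
  inv_mul_inv (a : S) : a⁻¹ * a * a⁻¹ = a⁻¹
  eq_inv (a b : S) : a * b * a = a → b * a * b = b → b = a⁻¹

/-- An inverse monoid with a zero. -/
class InverseMonoidWithZero (M : Type u) extends InverseSemigroup M, MonoidWithZero M

/-- The natural partial order `a ≤ b`, that is, `a = b a⁻¹ a`. -/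
def NatLE {S : Type u} [InverseSemigroup S] (a b : S) : Prop := a = b * (a⁻¹ * a)

/-- The compatibility relation: `a⁻¹ b` and `a b⁻¹` are idempotents. -/
def Compatible {S : Type u} [InverseSemigroup S] (a b : S) : Prop :=
  IsIdempotentElem (a⁻¹ * b) ∧ IsIdempotentElem (a * b⁻¹)

/-- `c` is the join (least upper bound) of `a` and `b` in the natural partial order. -/
def IsJoin {S : Type u} [InverseSemigroup S] (a b c : S) : Prop :=
  NatLE a c ∧ NatLE b c ∧ ∀ d : S, NatLE a d → NatLE b d → NatLE c d

/-- A distributive inverse semigroup: compatible pairs have joins, and multiplication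
distributes over these joins. -/
structure IsDistributive (S : Type u) [InverseSemigroup S] : Prop where
  exists_join : ∀ a b : S, Compatible a b → ∃ c, IsJoin a b c
  mul_join : ∀ s a b c : S, Compatible a b → IsJoin a b c → IsJoin (s * a) (s * b) (s * c)
  join_mul : ∀ s a b c : S, Compatible a b → IsJoin a b c → IsJoin (a * s) (b * s) (c * s)

/-- A Boolean inverse monoid: a distributive inverse monoid with zero whose idempotents form
a Boolean algebra under the natural partial order. -/
structure IsBooleanInverseMonoid (M : Type u) [InverseMonoidWithZero M] : Prop where
  distributive : IsDistributive M
  boolean : ∃ _ : BooleanAlgebra {e : M // IsIdempotentElem e},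
    ∀ e f : {e : M // IsIdempotentElem e}, e ≤ f ↔ NatLE (e : M) (f : M)

namespace InverseSemigroup

/-- Inverse semigroups from identities. -/
abbrev ofIdentities (S : Type u) [hS : Semigroup S] [hI : Inv S]
    (h1 : ∀ a : S, a * a⁻¹ * a = a) (h2 : ∀ a : S, a⁻¹⁻¹ = a)
    (h3 : ∀ a b : S, a * a⁻¹ * (b * b⁻¹) = b * b⁻¹ * (a * a⁻¹)) : InverseSemigroup S :=
  have h4 : ∀ a : S, a⁻¹ * a * a⁻¹ = a⁻¹ := fun a => by
    have := h1 a⁻¹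
    rwa [h2] at this
  have h5 : ∀ e : S, e * e = e → e = e⁻¹ := fun e he => by
    have hc := h3 e e⁻¹
    have e1 := h1 e
    have e2 := h4 e
    have hi : e⁻¹ * e⁻¹ * e⁻¹⁻¹ = e⁻¹ := by
      have := h3 e⁻¹ e
      rw [h2] at this ⊢
      grind
    rw [h2] at hc
    grind
  have h6 : ∀ e f : S, e * e = e → f * f = f → e * f = f * e := fun e f he hf => by
    have := h3 e f
    rwa [← h5 e he, ← h5 f hf, he, hf] at this
  { hS, hI with
    mul_inv_mul := h1
    inv_mul_inv := h4
    eq_inv := fun a b hab hba => by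
      have e1 := h1 a
      have e2 := h4 a
      have c1 := h6 (a * b) (a * a⁻¹) (by grind) (by grind)
      have c2 := h6 (b * a) (a⁻¹ * a) (by grind) (by grind)
      grind }

variable {S : Type u} [InverseSemigroup S]

theorem idem_inv {e : S} (he : e * e = e) : e⁻¹ = e :=
  (eq_inv e e (by rw [he, he]) (by rw [he, he])).symm

theorem inv_inv' (a : S) : a⁻¹⁻¹ = a :=
  (eq_inv a⁻¹ a (inv_mul_inv a) (mul_inv_mul a)).symm

theorem idem_mul {e f : S} (he : e * e = e) (hf : f * f = f) : e * f * (e * f) = e * f := by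
  have h1 := mul_inv_mul (e * f)
  have h2 := inv_mul_inv (e * f)
  generalize hx : (e * f)⁻¹ = x at h1 h2
  have h3 : f * x * e = x := by
    rw [← hx]
    rw [← hx] at h1 h2
    exact eq_inv _ _ (by grind) (by grind)
  have h4 : x * x = x := by grind
  have h5 : e * f = x := by
    rw [← idem_inv h4, ← hx, inv_inv']
  rw [h5, h4]

theorem idem_comm {e f : S} (he : e * e = e) (hf : f * f = f) : e * f = f * e := by
  have h1 := idem_mul he hf
  have h2 := idem_mul hf he
  have h3 : f * e = (e * f)⁻¹ := eq_inv _ _ (by grind) (by grind)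
  rw [h3, idem_inv h1]

theorem idem_dom (a : S) : a⁻¹ * a * (a⁻¹ * a) = a⁻¹ * a := by
  rw [← mul_assoc, inv_mul_inv]

theorem idem_ran (a : S) : a * a⁻¹ * (a * a⁻¹) = a * a⁻¹ := by
  rw [← mul_assoc, mul_inv_mul]

theorem idem_conj (a : S) {e : S} (he : e * e = e) :
    a⁻¹ * e * a * (a⁻¹ * e * a) = a⁻¹ * e * a := by
  have h1 := idem_comm he (idem_ran a)
  have h2 := mul_inv_mul a
  grind

theorem mul_inv_rev' (a b : S) : (a * b)⁻¹ = b⁻¹ * a⁻¹ := by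
  have h := idem_comm (idem_dom a) (idem_ran b)
  have a1 := mul_inv_mul a
  have a2 := inv_mul_inv a
  have b1 := mul_inv_mul b
  have b2 := inv_mul_inv b
  exact (eq_inv _ _ (by grind) (by grind)).symm

theorem mul_idem (a : S) {e : S} (he : e * e = e) : a * e = a * e * a⁻¹ * a := by
  have h := idem_comm he (idem_dom a)
  have a1 := mul_inv_mul a
  grind

theorem idem_mul_left (a : S) {e : S} (he : e * e = e) : e * a = a * (a⁻¹ * e * a) := by
  have h := idem_comm he (idem_ran a)
  have a1 := mul_inv_mul a
  grind

theorem dom_mul_eq {c y : S} (h : y * (y⁻¹ * c⁻¹ * c * y) = y) : c⁻¹ * c * y = y := by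
  have h1 := idem_comm (idem_dom c) (idem_ran y)
  have h2 := mul_inv_mul y
  grind

theorem dom_mul_idem (a : S) {f : S} (hf : f * f = f) :
    a⁻¹ * a * f = a⁻¹ * (a * f * a⁻¹) * a := by
  have h2 := idem_comm hf (idem_dom a)
  have h4 := inv_mul_inv a
  grind

theorem idem_mul_conj (a f : S) {e : S} (he : e * e = e) :
    e * (a * f * a⁻¹) = a * (a⁻¹ * e * a * f) * a⁻¹ := by
  have h2 := idem_comm he (idem_ran a)
  have h3 := mul_inv_mul a
  have h4 : a * (a⁻¹ * e * a) = e * a := by grind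
  calc e * (a * f * a⁻¹) = e * a * f * a⁻¹ := by simp only [mul_assoc]
    _ = a * (a⁻¹ * e * a) * f * a⁻¹ := by rw [h4]
    _ = _ := by simp only [mul_assoc]

theorem natLE_of_mul {a b e : S} (he : e * e = e) (h : a = b * e) : NatLE a b := by
  have h1 := idem_comm he (idem_dom b)
  have b1 := mul_inv_mul b
  have h2 : a⁻¹ = e * b⁻¹ := by rw [h, mul_inv_rev', idem_inv he]
  unfold NatLE
  rw [h2, h]
  grind

theorem natLE_of_mul_left {a b e : S} (he : e * e = e) (h : a = e * b) : NatLE a b :=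
  natLE_of_mul (idem_conj b he) (h.trans (idem_mul_left b he))

theorem NatLE.refl (a : S) : NatLE a a := by
  unfold NatLE
  rw [← mul_assoc, mul_inv_mul]

theorem NatLE.trans {a b c : S} (h1 : NatLE a b) (h2 : NatLE b c) : NatLE a c := by
  refine natLE_of_mul (idem_mul (idem_dom b) (idem_dom a)) ?_
  unfold NatLE at h1 h2
  rw [← mul_assoc, ← h2, ← h1]

theorem NatLE.inv {a b : S} (h : NatLE a b) : NatLE a⁻¹ b⁻¹ := by
  refine natLE_of_mul_left (idem_dom a) ?_
  conv_lhs => rw [show a = b * (a⁻¹ * a) from h, mul_inv_rev', idem_inv (idem_dom a)]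

theorem NatLE.mul {a b c d : S} (h1 : NatLE a b) (h2 : NatLE c d) :
    NatLE (a * c) (b * d) := by
  refine natLE_of_mul (idem_mul (idem_conj d (idem_dom a)) (idem_dom c)) ?_
  have h3 := idem_mul_left d (idem_dom a)
  calc a * c = b * (a⁻¹ * a) * (d * (c⁻¹ * c)) := by rw [← show a = _ from h1, ← show c = _ from h2]
    _ = b * ((a⁻¹ * a) * d) * (c⁻¹ * c) := by simp only [mul_assoc]
    _ = _ := by rw [h3]; simp only [mul_assoc]

/-- Two elements with a common upper bound have a common lower bound. -/
theorem exists_natLE {z t w : S} (h1 : NatLE z t) (h2 : NatLE w t) :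
    ∃ y, NatLE y z ∧ NatLE y w := by
  refine ⟨z * (w⁻¹ * w), natLE_of_mul (idem_dom w) rfl, natLE_of_mul (idem_dom z) ?_⟩
  have h3 := idem_comm (idem_dom w) (idem_dom z)
  calc z * (w⁻¹ * w) = t * (z⁻¹ * z) * (w⁻¹ * w) := by rw [← show z = _ from h1]
    _ = t * (w⁻¹ * w) * (z⁻¹ * z) := by rw [mul_assoc, ← h3, ← mul_assoc]
    _ = _ := by rw [← show w = _ from h2]

/-- If a congruence is compatible with inverses, its quotient is an inverse semigroup. -/
abbrev ofCon (c : Con S) (hc : ∀ a b : S, c a b → c a⁻¹ b⁻¹) : InverseSemigroup c.Quotient :=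
  letI : Inv c.Quotient := ⟨Quotient.map' (fun a => a⁻¹) hc⟩
  ofIdentities c.Quotient
    (fun a => Con.induction_on a fun a => congrArg (fun x : S => (x : c.Quotient)) (mul_inv_mul a))
    (fun a => Con.induction_on a fun a => congrArg (fun x : S => (x : c.Quotient)) (inv_inv' a))
    (fun a b => Con.induction_on₂ a b fun a b =>
      congrArg (fun x : S => (x : c.Quotient)) (idem_comm (idem_ran a) (idem_ran b)))

end InverseSemigroup

open InverseSemigroup

/-! ### The minimum group congruence -/

section Sigma

variable (S : Type u) [InverseSemigroup S]

/-- The minimum group congruence `σ`: `s σ t` iff there is `z ≤ s, t`. -/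
def sigmaCon : Con S where
  r s t := ∃ z, NatLE z s ∧ NatLE z t
  iseqv :=
    { refl := fun s => ⟨s, NatLE.refl s, NatLE.refl s⟩
      symm := fun ⟨z, h1, h2⟩ => ⟨z, h2, h1⟩
      trans := fun ⟨_, h1, h2⟩ ⟨_, h3, h4⟩ => by
        obtain ⟨y, hy1, hy2⟩ := exists_natLE h2 h3
        exact ⟨y, hy1.trans h1, hy2.trans h4⟩ }
  mul' := fun ⟨z, h1, h2⟩ ⟨w, h3, h4⟩ => ⟨z * w, h1.mul h3, h2.mul h4⟩

/-- The quotient `S / σ`. -/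
def SigmaQuotient : Type u := (sigmaCon S).Quotient

instance : InverseSemigroup (SigmaQuotient S) :=
  ofCon (sigmaCon S) fun _ _ ⟨z, h1, h2⟩ => ⟨z⁻¹, h1.inv, h2.inv⟩

variable {S} in
theorem sigma_idem {e f : S} (he : e * e = e) (hf : f * f = f) : sigmaCon S e f :=
  ⟨e * f, natLE_of_mul hf rfl, natLE_of_mul_left he rfl⟩

/-- `S / σ` is a group. -/
noncomputable instance [Nonempty S] : Group (SigmaQuotient S) :=
  letI a : S := Classical.arbitrary S
  letI : One (SigmaQuotient S) := ⟨((a * a⁻¹ : S) : (sigmaCon S).Quotient)⟩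
  { (inferInstance : InverseSemigroup (SigmaQuotient S)) with
    one_mul := fun x => Con.induction_on x fun s =>
      (Con.eq (sigmaCon S)).2 ⟨a * a⁻¹ * s, NatLE.refl _, natLE_of_mul_left (idem_ran a) rfl⟩
    mul_one := fun x => Con.induction_on x fun s =>
      (Con.eq (sigmaCon S)).2 ⟨s * (a * a⁻¹), NatLE.refl _, natLE_of_mul (idem_ran a) rfl⟩
    inv_mul_cancel := fun x => Con.induction_on x fun s =>
      (Con.eq (sigmaCon S)).2 (sigma_idem (idem_dom s) (idem_ran a)) }

end Sigma

/-! ### The Lenz congruence and the essential part -/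

section Lenz

variable (M : Type u) [InverseMonoidWithZero M]

variable {M} in
/-- Every nonzero `x ≤ s` has a common nonzero lower bound with `t`. -/
def LenzBelow (s t : M) : Prop :=
  ∀ x : M, x ≠ 0 → NatLE x s → ∃ z : M, z ≠ 0 ∧ NatLE z x ∧ NatLE z t

variable {M}

theorem LenzBelow.trans {s t r : M} (h1 : LenzBelow s t) (h2 : LenzBelow t r) :
    LenzBelow s r := fun x hx hxs => by
  obtain ⟨z, hz, hzx, hzt⟩ := h1 x hx hxs
  obtain ⟨w, hw, hwz, hwr⟩ := h2 z hz hzt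
  exact ⟨w, hw, hwz.trans hzx, hwr⟩

theorem inv_ne_zero' {x : M} (hx : x ≠ 0) : x⁻¹ ≠ 0 := fun h => hx (by
  rw [← mul_inv_mul x, h, mul_zero, zero_mul])

theorem LenzBelow.inv {s t : M} (h : LenzBelow s t) : LenzBelow s⁻¹ t⁻¹ := fun x hx hxs => by
  obtain ⟨z, hz, hzx, hzt⟩ := h x⁻¹ (inv_ne_zero' hx) (by simpa only [inv_inv'] using hxs.inv)
  exact ⟨z⁻¹, inv_ne_zero' hz, by simpa only [inv_inv'] using hzx.inv, hzt.inv⟩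

theorem LenzBelow.mul_left {s t : M} (h : LenzBelow s t) (c : M) :
    LenzBelow (c * s) (c * t) := fun x hx hxs => by
  have he := idem_dom x
  have hx' : x = c * (s * (x⁻¹ * x)) := by rw [← mul_assoc]; exact hxs
  set y := s * (x⁻¹ * x) with hy
  have hye : y * (x⁻¹ * x) = y := by rw [hy, mul_assoc, he]
  have hxx : x⁻¹ * x = y⁻¹ * c⁻¹ * c * y := by
    conv_lhs => rw [hx', mul_inv_rev']
    simp only [mul_assoc]
  have hcy : c⁻¹ * c * y = y := by
    rw [hxx] at hye
    exact dom_mul_eq hye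
  have hy0 : y ≠ 0 := fun h0 => hx (by rw [hx', h0, mul_zero])
  obtain ⟨z, hz, hzy, hzt⟩ := h y hy0 (natLE_of_mul he hy)
  refine ⟨c * z, fun h0 => hz ?_, ?_, (NatLE.refl c).mul hzt⟩
  · have h1 : c⁻¹ * c * z = z := by
      rw [show z = y * (z⁻¹ * z) from hzy, ← mul_assoc, hcy]
    rw [← h1, mul_assoc, h0, mul_zero]
  · rw [hx']
    exact (NatLE.refl c).mul hzy

theorem LenzBelow.mul_right {s t : M} (h : LenzBelow s t) (c : M) :
    LenzBelow (s * c) (t * c) := by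
  have := (h.inv.mul_left c⁻¹).inv
  simpa only [mul_inv_rev', inv_inv'] using this

variable (M)

/-- The Lenz congruence `≡`. -/
def lenzCon : Con M where
  r s t := LenzBelow s t ∧ LenzBelow t s
  iseqv :=
    { refl := fun _ => ⟨fun x hx h => ⟨x, hx, NatLE.refl x, h⟩, fun x hx h => ⟨x, hx, NatLE.refl x, h⟩⟩
      symm := fun h => ⟨h.2, h.1⟩
      trans := fun h1 h2 => ⟨h1.1.trans h2.1, h2.2.trans h1.2⟩ }
  mul' := fun h1 h2 =>
    ⟨(h1.1.mul_right _).trans (h2.1.mul_left _), (h1.2.mul_right _).trans (h2.2.mul_left _)⟩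

/-- The Lenz quotient `M / ≡`. -/
def LenzQuotient : Type u := (lenzCon M).Quotient

instance : InverseMonoidWithZero (LenzQuotient M) :=
  { ofCon (lenzCon M) (fun _ _ h => ⟨h.1.inv, h.2.inv⟩),
    (inferInstance : Monoid (lenzCon M).Quotient) with
    zero := ((0 : M) : (lenzCon M).Quotient)
    zero_mul := fun a => Con.induction_on a fun a =>
      congrArg (fun x : M => (x : (lenzCon M).Quotient)) (zero_mul a)
    mul_zero := fun a => Con.induction_on a fun a =>
      congrArg (fun x : M => (x : (lenzCon M).Quotient)) (mul_zero a) }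

variable {M}

/-- An essential idempotent: a nonzero idempotent `e` with `e f ≠ 0` for all nonzero
idempotents `f`. -/
def IsEssentialIdem (e : M) : Prop :=
  IsIdempotentElem e ∧ e ≠ 0 ∧ ∀ f : M, IsIdempotentElem f → f ≠ 0 → e * f ≠ 0

theorem IsEssentialIdem.conj {e a : M} (he : IsEssentialIdem e)
    (ha : IsEssentialIdem (a⁻¹ * a)) : IsEssentialIdem (a⁻¹ * e * a) := by
  have key : ∀ f : M, IsIdempotentElem f → f ≠ 0 → a⁻¹ * e * a * f ≠ 0 := by
    intro f hf hf0 h0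
    have h1 : a * f * a⁻¹ ≠ 0 := fun h => ha.2.2 f hf hf0 (by
      rw [dom_mul_idem a hf, h, mul_zero, zero_mul])
    have hi : IsIdempotentElem (a * f * a⁻¹) := by
      have := idem_conj a⁻¹ hf
      rwa [inv_inv'] at this
    refine he.2.2 _ hi h1 ?_
    rw [idem_mul_conj a f he.1, h0, mul_zero, zero_mul]
  refine ⟨idem_conj a he.1, fun h0 => ?_, key⟩
  exact key _ ha.1 ha.2.1 (by rw [h0, zero_mul])

variable (M)

/-- The inverse semigroup `Mᵉ` of essential elements of `M`. -/
def EssentialPart : Type u :=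
  {s : M // IsEssentialIdem (s⁻¹ * s) ∧ IsEssentialIdem (s * s⁻¹)}

instance : InverseSemigroup (EssentialPart M) where
  mul s t := ⟨s.1 * t.1, by
    have h := s.2.1.conj t.2.1
    simpa only [mul_inv_rev', mul_assoc] using h, by
    have h := IsEssentialIdem.conj (a := s.1⁻¹) t.2.2 (by rw [inv_inv']; exact s.2.2)
    simpa only [mul_inv_rev', inv_inv', mul_assoc] using h⟩
  inv s := ⟨s.1⁻¹, by rw [inv_inv']; exact s.2.2, by rw [inv_inv']; exact s.2.1⟩
  mul_assoc a b c := Subtype.ext (mul_assoc a.1 b.1 c.1)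
  mul_inv_mul a := Subtype.ext (mul_inv_mul a.1)
  inv_mul_inv a := Subtype.ext (inv_mul_inv a.1)
  eq_inv a b h1 h2 := Subtype.ext
    (eq_inv a.1 b.1 (congrArg Subtype.val h1) (congrArg Subtype.val h2))

instance [Nontrivial M] : Nonempty (EssentialPart M) := by
  have h1 : (1 : M)⁻¹ = 1 := idem_inv (mul_one 1)
  have h : IsEssentialIdem ((1 : M) * 1) :=
    ⟨by simp [IsIdempotentElem], by simp, fun f _ hf => by simpa using hf⟩
  exact ⟨⟨1, by rwa [h1], by rwa [h1]⟩⟩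

end Lenz

/-! ### Right ideals of a category -/

/-- The arrows of a category, gathered in one type. -/
@[ext] structure Arr (C : Type u) [Category.{v} C] where
  {dom : C}
  {cod : C}
  hom : dom ⟶ cod

section Cat

variable {C : Type u} [Category.{v} C]

/-- `IsProd a b c` says that the product `ab` is defined (the domain of `a` is the codomain
of `b`) and equals `c`. -/
inductive IsProd : Arr C → Arr C → Arr C → Prop
  | mk {x y z : C} (a : y ⟶ z) (b : x ⟶ y) : IsProd ⟨a⟩ ⟨b⟩ ⟨b ≫ a⟩

/-- The right ideal `XC` generated by `X`. -/
def genIdeal (X : Set (Arr C)) : Set (Arr C) :=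
  {c | ∃ x ∈ X, ∃ s, IsProd x s c}

/-- Finitely generated right ideals. -/
def IsFGIdeal (A : Set (Arr C)) : Prop :=
  ∃ X : Set (Arr C), X.Finite ∧ A = genIdeal X

variable (C) in
/-- A category is finitely aligned if every `aC ∩ bC` is a finitely generated right ideal. -/
class FinitelyAligned : Prop where
  inter_fg : ∀ a b : Arr C, IsFGIdeal (genIdeal {a} ∩ genIdeal {b})

theorem IsProd.eq {a b c c' : Arr C} (h : IsProd a b c) (h' : IsProd a b c') : c = c' := by
  cases h; cases h'; rfl

theorem IsProd.comp {a b c : Arr C} (h : IsProd a b c) : a.dom = b.cod := by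
  cases h; rfl

theorem IsProd.dom_eq {a b c : Arr C} (h : IsProd a b c) : c.dom = b.dom := by
  cases h; rfl

theorem IsProd.cod_eq {a b c : Arr C} (h : IsProd a b c) : c.cod = a.cod := by
  cases h; rfl

theorem IsProd.exists {a b : Arr C} (h : a.dom = b.cod) : ∃ c, IsProd a b c := by
  obtain ⟨a⟩ := a
  obtain ⟨b⟩ := b
  cases h
  exact ⟨_, .mk a b⟩

theorem IsProd.mul_id (a : Arr C) : IsProd a ⟨𝟙 a.dom⟩ a := by
  obtain ⟨a⟩ := a
  have := IsProd.mk a (𝟙 _)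
  rwa [Category.id_comp] at this

theorem IsProd.id_mul (a : Arr C) : IsProd ⟨𝟙 a.cod⟩ a a := by
  obtain ⟨a⟩ := a
  have := IsProd.mk (𝟙 _) a
  rwa [Category.comp_id] at this

/-- `(ab)s = a(bs)`. -/
theorem IsProd.assoc {a b c s t : Arr C} (h : IsProd a b c) (h' : IsProd c s t) :
    ∃ r, IsProd b s r ∧ IsProd a r t := by
  obtain ⟨a, b⟩ := h
  cases h' with
  | mk _ s =>
  refine ⟨_, .mk b s, ?_⟩
  rw [← Category.assoc]
  exact .mk a _

theorem genIdeal_mul {X : Set (Arr C)} {c s t : Arr C} (hc : c ∈ genIdeal X)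
    (h : IsProd c s t) : t ∈ genIdeal X := by
  obtain ⟨x, hx, r, hr⟩ := hc
  obtain ⟨q, -, hq⟩ := hr.assoc h
  exact ⟨x, hx, q, hq⟩

theorem subset_genIdeal (X : Set (Arr C)) : X ⊆ genIdeal X :=
  fun x hx => ⟨x, hx, _, IsProd.mul_id x⟩

theorem IsFGIdeal.iUnion {ι : Type*} {s : Set ι} (hs : s.Finite) {A : ι → Set (Arr C)}
    (hA : ∀ i ∈ s, IsFGIdeal (A i)) : IsFGIdeal (⋃ i ∈ s, A i) := by
  choose! X hX hAX using hA
  refine ⟨⋃ i ∈ s, X i, hs.biUnion hX, ?_⟩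
  ext c
  simp only [Set.mem_iUnion, genIdeal, Set.mem_ofPred_eq, exists_prop]
  constructor
  · rintro ⟨i, hi, hc⟩
    rw [hAX i hi] at hc
    obtain ⟨x, hx, r⟩ := hc
    exact ⟨x, ⟨i, hi, hx⟩, r⟩
  · rintro ⟨x, ⟨i, hi, hx⟩, r⟩
    exact ⟨i, hi, by rw [hAX i hi]; exact ⟨x, hx, r⟩⟩

theorem IsFGIdeal.inter [FinitelyAligned C] {A B : Set (Arr C)} (hA : IsFGIdeal A)
    (hB : IsFGIdeal B) : IsFGIdeal (A ∩ B) := by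
  obtain ⟨X, hX, rfl⟩ := hA
  obtain ⟨Y, hY, rfl⟩ := hB
  have := IsFGIdeal.iUnion (hX.prod hY) (A := fun p : Arr C × Arr C =>
    genIdeal {p.1} ∩ genIdeal {p.2}) fun p _ => FinitelyAligned.inter_fg p.1 p.2
  convert this using 1
  ext c
  simp only [genIdeal, Set.mem_inter_iff, Set.mem_ofPred_eq, Set.mem_iUnion, Set.mem_prod,
    Set.mem_singleton_iff, exists_prop, exists_eq_left, Prod.exists]
  constructor
  · rintro ⟨⟨x, hx, h1⟩, y, hy, h2⟩
    exact ⟨x, y, ⟨hx, hy⟩, h1, h2⟩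
  · rintro ⟨x, y, ⟨hx, hy⟩, h1, h2⟩
    exact ⟨⟨x, hx, h1⟩, y, hy, h2⟩

theorem IsFGIdeal.univ [Finite C] : IsFGIdeal (Set.univ : Set (Arr C)) := by
  refine ⟨Set.range fun x : C => ⟨𝟙 x⟩, Set.finite_range _, ?_⟩
  ext c
  simp only [Set.mem_univ, true_iff]
  exact ⟨_, ⟨c.cod, rfl⟩, c, IsProd.id_mul c⟩

theorem IsFGIdeal.empty : IsFGIdeal (∅ : Set (Arr C)) :=
  ⟨∅, Set.finite_empty, by ext; simp [genIdeal]⟩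

/-! ### The inverse monoid of bijective morphisms -/

variable (C) in
/-- `R(C)`: the bijective morphisms between finitely generated right ideals of `C`, as partial
bijections `θ` of the set of arrows with `θ (rs) = θ(r) s` whenever `θ` is defined at `r` and
`rs` is defined. -/
@[ext] structure BijMor where
  toPEquiv : Arr C ≃. Arr C
  domain_fg : IsFGIdeal {a | ∃ b, toPEquiv a = some b}
  range_fg : IsFGIdeal {b | ∃ a, toPEquiv a = some b}
  map_mul : ∀ r r' s t : Arr C, toPEquiv r = some r' → IsProd r s t →
    ∃ t', toPEquiv t = some t' ∧ IsProd r' s t'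

namespace BijMor

variable (θ φ : BijMor C)

theorem symm_iff {a b : Arr C} : θ.toPEquiv.symm b = some a ↔ θ.toPEquiv a = some b :=
  PEquiv.eq_some_iff _

theorem dom_eq {r r' : Arr C} (h : θ.toPEquiv r = some r') : r'.dom = r.dom := by
  obtain ⟨t', -, h2⟩ := θ.map_mul r r' _ r h (IsProd.mul_id r)
  exact h2.comp

/-- The inverse partial bijection. -/
def symm : BijMor C where
  toPEquiv := θ.toPEquiv.symm
  domain_fg := by simpa only [symm_iff] using θ.range_fg
  range_fg := by simpa only [symm_iff] using θ.domain_fg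
  map_mul r r' s t h hp := by
    rw [symm_iff] at h
    obtain ⟨q, hq⟩ := IsProd.exists (a := r') (b := s) ((θ.dom_eq h).symm.trans hp.comp)
    obtain ⟨t', h1, h2⟩ := θ.map_mul _ _ _ _ h hq
    cases h2.eq hp
    exact ⟨q, θ.symm_iff.2 h1, hq⟩

theorem image_fg {A : Set (Arr C)} (hA : IsFGIdeal A)
    (hAθ : A ⊆ {a | ∃ b, θ.toPEquiv a = some b}) :
    IsFGIdeal {b | ∃ a ∈ A, θ.toPEquiv a = some b} := by
  obtain ⟨X, hX, rfl⟩ := hA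
  refine ⟨{b | ∃ a ∈ X, θ.toPEquiv a = some b}, ?_, ?_⟩
  · have : {b | ∃ a ∈ X, θ.toPEquiv a = some b} ⊆
        ⋃ a ∈ X, {b | θ.toPEquiv a = some b} := by
      rintro b ⟨a, ha, hb⟩
      simp only [Set.mem_iUnion]
      exact ⟨a, ha, hb⟩
    refine (hX.biUnion fun a _ => Set.Subsingleton.finite ?_).subset this
    intro b hb b' hb'
    exact Option.some.inj (hb.symm.trans hb')
  · ext b
    constructor
    · rintro ⟨a, ⟨x, hx, s, hs⟩, hab⟩
      obtain ⟨y, hy⟩ := hAθ (subset_genIdeal X hx)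
      obtain ⟨t', h1, h2⟩ := θ.map_mul _ _ _ _ hy hs
      cases h1.symm.trans hab
      exact ⟨y, ⟨x, hx, hy⟩, s, h2⟩
    · rintro ⟨y, ⟨x, hx, hy⟩, s, hs⟩
      obtain ⟨a, ha⟩ := IsProd.exists (a := x) (b := s) ((θ.dom_eq hy).symm.trans hs.comp)
      obtain ⟨t', h1, h2⟩ := θ.map_mul _ _ _ _ hy ha
      cases h2.eq hs
      exact ⟨a, ⟨x, hx, s, ha⟩, h1⟩

/-- The composite `θ ∘ φ` of partial bijections. -/
def comp [FinitelyAligned C] : BijMor C where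
  toPEquiv := φ.toPEquiv.trans θ.toPEquiv
  domain_fg := by
    have h := φ.symm.image_fg (φ.range_fg.inter θ.domain_fg)
      (fun b hb => by simpa only [symm, symm_iff] using hb.1)
    convert h using 1
    ext a
    simp only [PEquiv.trans_eq_some, Set.mem_ofPred_eq, Set.mem_inter_iff, symm, symm_iff]
    constructor
    · rintro ⟨c, b, h1, h2⟩
      exact ⟨b, ⟨⟨a, h1⟩, c, h2⟩, h1⟩
    · rintro ⟨b, ⟨-, c, h2⟩, h1⟩
      exact ⟨c, b, h1, h2⟩
  range_fg := by
    have h := θ.image_fg (φ.range_fg.inter θ.domain_fg) (fun b hb => hb.2)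
    convert h using 1
    ext c
    simp only [PEquiv.trans_eq_some, Set.mem_ofPred_eq, Set.mem_inter_iff]
    constructor
    · rintro ⟨a, b, h1, h2⟩
      exact ⟨b, ⟨⟨a, h1⟩, c, h2⟩, h2⟩
    · rintro ⟨b, ⟨⟨a, h1⟩, -⟩, h2⟩
      exact ⟨a, b, h1, h2⟩
  map_mul r r' s t h hp := by
    rw [PEquiv.trans_eq_some] at h
    obtain ⟨q, h1, h2⟩ := h
    obtain ⟨t1, h3, h4⟩ := φ.map_mul _ _ _ _ h1 hp
    obtain ⟨t2, h5, h6⟩ := θ.map_mul _ _ _ _ h2 h4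
    exact ⟨t2, (PEquiv.trans_eq_some _ _ _ _).2 ⟨t1, h3, h5⟩, h6⟩

instance : Inv (BijMor C) := ⟨symm⟩

theorem ext_iff' {θ φ : BijMor C}
    (h : ∀ a b, θ.toPEquiv a = some b ↔ φ.toPEquiv a = some b) : θ = φ :=
  BijMor.ext (PEquiv.ext fun a => Option.ext fun b => h a b)

theorem inv_apply {θ : BijMor C} {a b : Arr C} :
    θ⁻¹.toPEquiv a = some b ↔ θ.toPEquiv b = some a :=
  θ.symm_iff

instance : Zero (BijMor C) where
  zero :=
    { toPEquiv := ⊥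
      domain_fg := by simpa using IsFGIdeal.empty
      range_fg := by simpa using IsFGIdeal.empty
      map_mul := fun r r' s t h => by simp at h }

theorem zero_apply (a : Arr C) : (0 : BijMor C).toPEquiv a = none := rfl

instance [Finite C] : One (BijMor C) where
  one :=
    { toPEquiv := PEquiv.refl _
      domain_fg := by simpa using IsFGIdeal.univ
      range_fg := by simpa using IsFGIdeal.univ
      map_mul := fun r r' s t h hp => by
        cases Option.some.inj h
        exact ⟨t, rfl, hp⟩ }

variable [FinitelyAligned C]

instance : Mul (BijMor C) := ⟨fun θ φ => comp θ φ⟩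

instance : Semigroup (BijMor C) where
  mul_assoc a b c := BijMor.ext
    (PEquiv.trans_assoc c.toPEquiv b.toPEquiv a.toPEquiv).symm

theorem mul_apply {θ φ : BijMor C} {a c : Arr C} : (θ * φ).toPEquiv a = some c ↔
    ∃ b, φ.toPEquiv a = some b ∧ θ.toPEquiv b = some c :=
  PEquiv.trans_eq_some φ.toPEquiv θ.toPEquiv a c

theorem mul_inv_apply {θ : BijMor C} {a b : Arr C} : (θ * θ⁻¹).toPEquiv a = some b ↔
    a = b ∧ ∃ c, θ.toPEquiv c = some a := by
  simp only [mul_apply, inv_apply]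
  constructor
  · rintro ⟨c, h1, h2⟩
    exact ⟨Option.some.inj (h1.symm.trans h2), c, h1⟩
  · rintro ⟨rfl, c, h⟩
    exact ⟨c, h, h⟩

instance : InverseSemigroup (BijMor C) := ofIdentities _
  (fun θ => ext_iff' fun a b => by
    simp only [mul_apply (θ := θ * θ⁻¹), mul_inv_apply]
    constructor
    · rintro ⟨c, h1, rfl, -⟩
      exact h1
    · intro h
      exact ⟨b, h, rfl, a, h⟩)
  (fun θ => ext_iff' fun a b => by simp only [inv_apply])
  (fun θ φ => ext_iff' fun a b => by
    simp only [mul_apply (θ := θ * θ⁻¹), mul_apply (θ := φ * φ⁻¹), mul_inv_apply]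
    constructor
    · rintro ⟨c, ⟨rfl, h1⟩, rfl, h2⟩
      exact ⟨a, ⟨rfl, h2⟩, rfl, h1⟩
    · rintro ⟨c, ⟨rfl, h1⟩, rfl, h2⟩
      exact ⟨a, ⟨rfl, h2⟩, rfl, h1⟩)

instance [Finite C] : InverseMonoidWithZero (BijMor C) where
  one_mul θ := BijMor.ext (PEquiv.trans_refl θ.toPEquiv)
  mul_one θ := BijMor.ext (PEquiv.refl_trans θ.toPEquiv)
  zero_mul θ := BijMor.ext (PEquiv.trans_bot θ.toPEquiv)
  mul_zero θ := BijMor.ext (PEquiv.bot_trans θ.toPEquiv)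

instance [Finite C] [h : Nonempty C] : Nontrivial (BijMor C) :=
  ⟨⟨1, 0, fun h0 => by
    obtain ⟨x⟩ := h
    have h1 : (1 : BijMor C).toPEquiv ⟨𝟙 x⟩ = some ⟨𝟙 x⟩ := rfl
    rw [h0, zero_apply] at h1
    exact Option.some_ne_none _ h1.symm⟩⟩

end BijMor

variable (C)

/-- `B(C) = R(C) / ≡`. -/
abbrev BooleanQuotient [FinitelyAligned C] [Finite C] : Type (max u v) :=
  LenzQuotient (BijMor C)

/-- `G(C) = R(C)ᵉ / σ`. -/
abbrev CategoryGroup [FinitelyAligned C] [Finite C] : Type (max u v) :=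
  SigmaQuotient (EssentialPart (BijMor C))

/-! ### Higher rank graphs -/

/-- A higher rank graph: a countable category with a degree functor to `ℕᵏ` (`k = rank`) that
has the unique factorization property. The product `ab` of arrows is `b ≫ a`. -/
class HigherRankGraph where
  countable_obj : Countable C
  countable_hom : ∀ x y : C, Countable (x ⟶ y)
  rank : ℕ
  degree : ∀ {x y : C}, (x ⟶ y) → Fin rank → ℕ
  degree_id : ∀ x : C, degree (𝟙 x) = 0
  degree_comp : ∀ {x y z : C} (b : x ⟶ y) (a : y ⟶ z), degree (b ≫ a) = degree a + degree b
  factorization : ∀ {x z : C} (a : x ⟶ z) (m n : Fin rank → ℕ), degree a = m + n →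
    ∃! p : Σ y : C, (y ⟶ z) × (x ⟶ y),
      a = p.2.2 ≫ p.2.1 ∧ degree p.2.1 = m ∧ degree p.2.2 = n

open HigherRankGraph

/-- No sources: every identity is the codomain of an arrow of each degree. -/
class NoSources [HigherRankGraph C] : Prop where
  exists_arrow : ∀ (e : C) (m : Fin (rank C) → ℕ), ∃ (x : C) (a : x ⟶ e), degree a = m

/-- Row finite: for each identity `e` and degree `m`, finitely many arrows with codomain `e`
have degree `m`. -/
class RowFinite [HigherRankGraph C] : Prop where
  finite_arrows : ∀ (e : C) (m : Fin (rank C) → ℕ), {a : Σ x : C, (x ⟶ e) | degree a.2 = m}.Finite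

variable {C} in
theorem IsProd.degree [HigherRankGraph C] {a b c : Arr C} (h : IsProd a b c) :
    degree c.hom = degree a.hom + degree b.hom := by
  cases h
  exact degree_comp _ _

variable {C} in
theorem exists_factor [HigherRankGraph C] {c : Arr C} {m n : Fin (rank C) → ℕ}
    (h : degree c.hom = m + n) :
    ∃ a b : Arr C, IsProd a b c ∧ degree a.hom = m ∧ degree b.hom = n := by
  obtain ⟨c⟩ := c
  obtain ⟨⟨y, a, b⟩, ⟨rfl, h1, h2⟩, -⟩ := factorization c m n h
  exact ⟨⟨a⟩, ⟨b⟩, .mk a b, h1, h2⟩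

variable {C} in
theorem IsProd.left_unique [HigherRankGraph C] {a b a' b' c : Arr C} (h : IsProd a b c)
    (h' : IsProd a' b' c) (hd : HigherRankGraph.degree a.hom = HigherRankGraph.degree a'.hom) :
    a = a' := by
  have hb : HigherRankGraph.degree b.hom = HigherRankGraph.degree b'.hom :=
    add_left_cancel (h.degree.symm.trans (h'.degree.trans (by rw [hd])))
  obtain @⟨x, z, c⟩ := c
  have key : ∀ a b : Arr C, IsProd a b ⟨c⟩ → ∃ p : Σ y : C, (y ⟶ z) × (x ⟶ y),
      c = p.2.2 ≫ p.2.1 ∧ a = ⟨p.2.1⟩ ∧ b = ⟨p.2.2⟩ := by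
    rintro _ _ ⟨a, b⟩
    exact ⟨⟨_, a, b⟩, rfl, rfl, rfl⟩
  obtain ⟨p, hp, rfl, rfl⟩ := key a b h
  obtain ⟨q, hq, rfl, rfl⟩ := key a' b' h'
  have := (factorization c _ _ h.degree).unique ⟨hp, rfl, rfl⟩ ⟨hq, hd.symm, hb.symm⟩
  rw [this]

/-- A row finite higher rank graph is finitely aligned. -/
instance [HigherRankGraph C] [RowFinite C] : FinitelyAligned C where
  inter_fg a b := by
    let m := degree a.hom ⊔ degree b.hom
    refine ⟨{e | e ∈ genIdeal {a} ∩ genIdeal {b} ∧ degree e.hom = m}, ?_, ?_⟩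
    · refine ((RowFinite.finite_arrows a.cod m).image
        (fun p : Σ x : C, (x ⟶ a.cod) => (⟨p.2⟩ : Arr C))).subset ?_
      rintro ⟨e⟩ ⟨⟨⟨_, rfl, s, hs⟩, -⟩, he⟩
      cases hs
      exact ⟨⟨_, _⟩, he, rfl⟩
    · ext c
      constructor
      · rintro ⟨⟨_, rfl, u, hu⟩, _, rfl, w, hw⟩
        have hau := hu.degree
        have hbw := hw.degree
        have hm : m ≤ degree c.hom :=
          sup_le (hau ▸ le_self_add) (hbw ▸ le_self_add)
        obtain ⟨e, f, hef, he, -⟩ := exists_factor (add_tsub_cancel_of_le hm).symm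
        have key : ∀ a' u' : Arr C, IsProd a' u' c → degree a'.hom ≤ m →
            e ∈ genIdeal {a'} := by
          intro a' u' h' hle
          obtain ⟨p, q, hpq, hp, -⟩ :=
            exists_factor (he.trans (add_tsub_cancel_of_le hle).symm)
          obtain ⟨r, -, hr⟩ := hpq.assoc hef
          cases hr.left_unique h' hp
          exact ⟨_, rfl, q, hpq⟩
        exact ⟨e, ⟨⟨key _ _ hu le_sup_left, key _ _ hw le_sup_right⟩, he⟩, f, hef⟩
      · rintro ⟨e, ⟨⟨h1, h2⟩, -⟩, f, hf⟩
        exact ⟨genIdeal_mul h1 hf, genIdeal_mul h2 hf⟩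

end Cat

/-!
The Lenz congruence `≡` on `R(C)` is *idempotent-pure*: if `θ ≡ θ⁻¹θ`, then every `r` in the
domain of `θ` has a multiple `rs` with `θ(r)s = θ(rs) = rs`; comparing degrees, `θ(r)` and `r` have
the same degree, so `θ(r) = r` by unique factorization (`BijMor.lenzIdemPure`). The theorem follows
from this fact and from the description of the order of the quotient: `[a] ≤ [b]` if and only if
each nonzero `x ≤ a` has a nonzero lower bound in common with `b` (`LenzQuotient.natLE_cls`).

*Joins.* If `[θ]` and `[φ]` are compatible, then `θ⁻¹φ` and `θφ⁻¹` are idempotent already in `R(C)`,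
so that `θ` and `φ` agree wherever both are defined, as do their inverses. Their union is thus again
a bijective morphism, and its class is the join of `[θ]` and `[φ]` (`BijMor.isJoin_cls`).
Composition distributes over unions of partial maps, and therefore over joins in `B(C)`.

*Complements.* An idempotent of `R(C)` is the identity on a right ideal `A = XC` with `X` finite. If
the degree `m` bounds the degrees of the elements of `X`, then an arrow of degree at least `m` lies
in `A` if and only if its factor of degree `m` does. The finitely many arrows of degree `m` outside
`A` generate an ideal `B` disjoint from `A`, and since there are no sources, every arrow has a
multiple in `A ∪ B`. So the class of the identity on `B` is the complement
(`BijMor.exists_compl`).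

*Units.* An idempotent `e` satisfies `e ≡ 1` if and only if it is essential. Hence `[s]` is a unit
if and only if `s` lies in the essential part. If moreover `[s] = [t]`, then `s⁻¹t` is an essential
idempotent by idempotent-purity, and `s s⁻¹ t` is a common lower bound of `s` and `t` in the
essential part; so `≡` restricts to `σ` there (`LenzQuotient.unitsEquiv`).
-/

/-! ### The natural partial order -/

namespace InverseSemigroup

variable {S : Type u} [InverseSemigroup S]

theorem NatLE.antisymm {a b : S} (h1 : NatLE a b) (h2 : NatLE b a) : a = b := by
  have h3 : a = b * (a⁻¹ * a) := h1
  have h4 : b = a * (b⁻¹ * b) := h2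
  have h5 : a * (b⁻¹ * b) = a :=
    calc a * (b⁻¹ * b) = b * (a⁻¹ * a) * (b⁻¹ * b) := by rw [← h3]
      _ = b * (b⁻¹ * b) * (a⁻¹ * a) := by
        rw [mul_assoc, idem_comm (idem_dom a) (idem_dom b), ← mul_assoc]
      _ = a := by rw [← mul_assoc b, mul_inv_mul, ← h3]
  rw [h4, h5]

theorem IsJoin.unique {a b c d : S} (hc : IsJoin a b c) (hd : IsJoin a b d) : c = d :=
  NatLE.antisymm (hc.2.2 d hd.1 hd.2.1) (hd.2.2 c hc.1 hc.2.1)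

theorem natLE_idem_iff {e f : S} (he : e * e = e) : NatLE e f ↔ e = f * e := by
  rw [NatLE, idem_inv he, he]

theorem compatible_idem {e f : S} (he : e * e = e) (hf : f * f = f) : Compatible e f := by
  rw [Compatible, idem_inv he, idem_inv hf]
  exact ⟨idem_mul he hf, idem_mul he hf⟩

theorem NatLE.dom {a b : S} (h : NatLE a b) : NatLE (a⁻¹ * a) (b⁻¹ * b) :=
  h.inv.mul h

/-- Elements below `b` are restrictions of `b`, so they are ordered as their domains are. -/
theorem NatLE.of_dom {x z b : S} (hx : NatLE x b) (hz : NatLE z b)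
    (h : NatLE (z⁻¹ * z) (x⁻¹ * x)) : NatLE z x := by
  refine natLE_of_mul (idem_dom z) ?_
  have h' := (natLE_idem_iff (idem_dom z)).1 h
  calc z = b * (z⁻¹ * z) := hz
    _ = b * (x⁻¹ * x * (z⁻¹ * z)) := by rw [← h']
    _ = b * (x⁻¹ * x) * (z⁻¹ * z) := by rw [← mul_assoc b]
    _ = x * (z⁻¹ * z) := by rw [← show x = _ from hx]

end InverseSemigroup

/-! ### Boolean algebras of idempotents -/

section Boolean

variable {S : Type u} [InverseMonoidWithZero S]

theorem natLE_one_iff {a : S} : NatLE a 1 ↔ IsIdempotentElem a := by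
  constructor
  · intro h
    rw [NatLE, one_mul] at h
    rw [h]
    exact idem_dom a
  · intro h
    exact natLE_of_mul h (one_mul a).symm

theorem zero_natLE (a : S) : NatLE 0 a :=
  natLE_of_mul (mul_zero 0) (mul_zero a).symm

theorem IsJoin.isIdempotentElem {e f c : S} (h : IsJoin e f c) (he : IsIdempotentElem e)
    (hf : IsIdempotentElem f) : IsIdempotentElem c :=
  natLE_one_iff.1 (h.2.2 1 (natLE_one_iff.2 he) (natLE_one_iff.2 hf))

/-- The idempotents of a distributive inverse monoid with zero form a bounded distributive lattice
with the product as meet; it is a Boolean algebra if every idempotent has a complement. -/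
theorem isBooleanInverseMonoid_of_compl (hS : IsDistributive S)
    (hc : ∀ e : S, IsIdempotentElem e →
      ∃ f : S, IsIdempotentElem f ∧ e * f = 0 ∧ IsJoin e f 1) :
    IsBooleanInverseMonoid S := by
  refine ⟨hS, ?_⟩
  have hj : ∀ e f : {e : S // IsIdempotentElem e},
      ∃ c : {e : S // IsIdempotentElem e}, IsJoin (e : S) f c := fun e f => by
    obtain ⟨c, h⟩ := hS.exists_join e.1 f.1 (compatible_idem e.2 f.2)
    exact ⟨⟨c, h.isIdempotentElem e.2 f.2⟩, h⟩
  choose sup hsup using hj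
  let L : Lattice {e : S // IsIdempotentElem e} :=
    { le := fun e f => NatLE (e : S) f
      le_refl := fun e => NatLE.refl _
      le_trans := fun _ _ _ h1 h2 => NatLE.trans h1 h2
      le_antisymm := fun _ _ h1 h2 => Subtype.ext (NatLE.antisymm h1 h2)
      sup := sup
      le_sup_left := fun e f => (hsup e f).1
      le_sup_right := fun e f => (hsup e f).2.1
      sup_le := fun e f c h1 h2 => (hsup e f).2.2 c h1 h2
      inf := fun e f => ⟨e.1 * f.1, idem_mul e.2 f.2⟩
      inf_le_left := fun e f => natLE_of_mul f.2 rfl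
      inf_le_right := fun e f => natLE_of_mul_left e.2 rfl
      le_inf := fun e f g h1 h2 => by
        have h := NatLE.mul h1 h2
        rwa [e.2] at h }
  let D : DistribLattice {e : S // IsIdempotentElem e} := DistribLattice.ofInfSupLe fun a b c =>
    (hS.mul_join a.1 b.1 c.1 _ (compatible_idem b.2 c.2) (hsup b c)).2.2 _
      (hsup (a ⊓ b) (a ⊓ c)).1 (hsup (a ⊓ b) (a ⊓ c)).2.1
  let B : BoundedOrder {e : S // IsIdempotentElem e} :=
    { top := ⟨1, mul_one 1⟩
      le_top := fun e => natLE_one_iff.2 e.2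
      bot := ⟨0, mul_zero 0⟩
      bot_le := fun e => zero_natLE e.1 }
  have K : ComplementedLattice {e : S // IsIdempotentElem e} := ⟨fun e => by
    obtain ⟨f, hf, h0, h1⟩ := hc e.1 e.2
    refine ⟨⟨f, hf⟩, IsCompl.of_le ?_ ?_⟩
    · exact le_of_eq (Subtype.ext h0)
    · exact h1.2.2 _ (hsup e ⟨f, hf⟩).1 (hsup e ⟨f, hf⟩).2.1⟩
  exact ⟨DistribLattice.booleanAlgebraOfComplemented _, fun _ _ => Iff.rfl⟩

end Boolean

/-! ### The Lenz quotient -/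

section LenzBelow

variable {M : Type u} [InverseMonoidWithZero M]

theorem NatLE.lenzBelow {a b : M} (h : NatLE a b) : LenzBelow a b :=
  fun x hx hxa => ⟨x, hx, NatLE.refl x, hxa.trans h⟩

theorem dom_ne_zero {x : M} (hx : x ≠ 0) : x⁻¹ * x ≠ 0 := fun h => hx (by
  rw [← mul_inv_mul x, mul_assoc, h, mul_zero])

/-- A nonzero idempotent `f` shares a nonzero lower bound with the idempotent `e` exactly when
`ef ≠ 0`, which is why the essential idempotents are those in the class of `1`. -/
theorem isEssentialIdem_iff_lenzBelow [Nontrivial M] {e : M} (he : IsIdempotentElem e) :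
    IsEssentialIdem e ↔ LenzBelow 1 e := by
  constructor
  · intro h x hx hx1
    have hxi := natLE_one_iff.1 hx1
    exact ⟨e * x, h.2.2 x hxi hx, natLE_of_mul_left he rfl, natLE_of_mul hxi rfl⟩
  · intro h
    have key : ∀ f : M, IsIdempotentElem f → f ≠ 0 → e * f ≠ 0 := fun f hf hf0 h0 => by
      obtain ⟨z, hz, hzf, hze⟩ := h f hf0 (natLE_one_iff.2 hf)
      have hzi := natLE_one_iff.1 (hzf.trans (natLE_one_iff.2 hf))
      have h1 := hze.mul hzf
      rw [hzi, h0] at h1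
      exact hz (NatLE.antisymm h1 (zero_natLE z))
    refine ⟨he, fun h0 => ?_, key⟩
    refine key 1 (mul_one 1) one_ne_zero ?_
    rw [h0, zero_mul]

end LenzBelow

namespace LenzQuotient

variable {M : Type u} [InverseMonoidWithZero M]

/-- The class of an element of `M` in `M / ≡`. -/
def cls (a : M) : LenzQuotient M := (a : (lenzCon M).Quotient)

theorem cls_mul (a b : M) : cls (a * b) = cls a * cls b := rfl

theorem cls_inv (a : M) : cls a⁻¹ = (cls a)⁻¹ := rfl

theorem cls_one : cls (1 : M) = 1 := rfl

theorem cls_eq_cls {a b : M} : cls a = cls b ↔ LenzBelow a b ∧ LenzBelow b a :=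
  Con.eq (lenzCon M)

theorem cls_surjective (x : LenzQuotient M) : ∃ a : M, cls a = x :=
  Con.induction_on x fun a => ⟨a, rfl⟩

/-- The order of the quotient is the one-sided half of the Lenz congruence. -/
theorem natLE_cls {a b : M} : NatLE (cls a) (cls b) ↔ LenzBelow a b := by
  have h0 : NatLE (cls a) (cls b) ↔ cls a = cls (b * (a⁻¹ * a)) := Iff.rfl
  rw [h0, cls_eq_cls]
  constructor
  · rintro ⟨h, -⟩
    exact h.trans (natLE_of_mul (idem_dom a) rfl).lenzBelow
  · intro h
    refine ⟨fun x hx hxa => ?_, fun x hx hxb => ?_⟩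
    · obtain ⟨z, hz, hzx, hzb⟩ := h x hx hxa
      refine ⟨z, hz, hzx, ?_⟩
      rw [NatLE] at hzb
      rw [hzb]
      exact (NatLE.refl b).mul (hzx.trans hxa).dom
    · -- `x` is the restriction of `b` to a part of the domain of `a`; a restriction of `a` to a
      -- smaller part that lies below `b` is therefore below `x`.
      have hxb' : NatLE x b := hxb.trans (natLE_of_mul (idem_dom a) rfl)
      have hdom : NatLE (x⁻¹ * x) (a⁻¹ * a) := by
        refine (natLE_idem_iff (idem_dom x)).2 ?_
        have hxa : x * (a⁻¹ * a) = x := by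
          have h1 : x = b * (a⁻¹ * a) * (x⁻¹ * x) := hxb
          calc x * (a⁻¹ * a) = b * (a⁻¹ * a) * (x⁻¹ * x) * (a⁻¹ * a) := by rw [← h1]
            _ = b * ((a⁻¹ * a) * (a⁻¹ * a)) * (x⁻¹ * x) := by
              rw [mul_assoc _ (x⁻¹ * x), idem_comm (idem_dom x) (idem_dom a)]
              simp only [mul_assoc]
            _ = x := by rw [idem_dom, ← h1]
        rw [idem_comm (idem_dom a) (idem_dom x), mul_assoc, hxa]
      have hd : (a * (x⁻¹ * x))⁻¹ * (a * (x⁻¹ * x)) = x⁻¹ * x := by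
        rw [mul_inv_rev', idem_inv (idem_dom x), mul_assoc, ← mul_assoc a⁻¹,
          ← (natLE_idem_iff (idem_dom x)).1 hdom, idem_dom]
      have hne : a * (x⁻¹ * x) ≠ 0 := fun h0 => dom_ne_zero hx (by rw [← hd, h0, mul_zero])
      obtain ⟨z, hz, hza, hzb⟩ := h _ hne (natLE_of_mul (idem_dom x) rfl)
      have hzd := hza.dom
      rw [hd] at hzd
      exact ⟨z, hz, NatLE.of_dom hxb' hzb hzd, hza.trans (natLE_of_mul (idem_dom x) rfl)⟩

theorem cls_eq_one_iff [Nontrivial M] {e : M} (he : IsIdempotentElem e) :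
    cls e = 1 ↔ IsEssentialIdem e := by
  rw [isEssentialIdem_iff_lenzBelow he, ← cls_one, cls_eq_cls]
  exact and_iff_right (natLE_one_iff.2 he).lenzBelow

end LenzQuotient

variable (M : Type u) [InverseMonoidWithZero M] in
/-- The Lenz congruence is idempotent-pure: only idempotents become idempotent in the quotient. -/
def LenzIdemPure : Prop :=
  ∀ a : M, IsIdempotentElem (LenzQuotient.cls a) → IsIdempotentElem a

/-! ### The group of units of the Lenz quotient -/

namespace LenzQuotient

variable {M : Type u} [InverseMonoidWithZero M]

/-- Two-sided inverses in an inverse monoid coincide with the inverses in the sense of inverse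
semigroups. -/
theorem eq_inv_of_units (u : (LenzQuotient M)ˣ) :
    (↑u⁻¹ : LenzQuotient M) = (u : LenzQuotient M)⁻¹ :=
  eq_inv _ _ (by rw [Units.mul_inv, one_mul]) (by rw [Units.inv_mul, one_mul])

variable [Nontrivial M]

/-- The class of an essential element is a unit of `M / ≡`. -/
def essentialUnit (s : EssentialPart M) : (LenzQuotient M)ˣ where
  val := cls s.1
  inv := cls s.1⁻¹
  val_inv := (cls_eq_one_iff (idem_ran s.1)).2 s.2.2
  inv_val := (cls_eq_one_iff (idem_dom s.1)).2 s.2.1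

theorem essentialUnit_mul (s t : EssentialPart M) :
    essentialUnit (s * t) = essentialUnit s * essentialUnit t :=
  Units.ext rfl

theorem essentialUnit_surjective (u : (LenzQuotient M)ˣ) :
    ∃ s : EssentialPart M, essentialUnit s = u := by
  obtain ⟨a, ha⟩ := cls_surjective (u : LenzQuotient M)
  refine ⟨⟨a, (cls_eq_one_iff (idem_dom a)).1 ?_, (cls_eq_one_iff (idem_ran a)).1 ?_⟩, Units.ext ha⟩
  · rw [cls_mul, cls_inv, ha, ← eq_inv_of_units, Units.inv_mul]
  · rw [cls_mul, cls_inv, ha, ← eq_inv_of_units, Units.mul_inv]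

theorem essentialUnit_eq_of_natLE {z s : EssentialPart M} (h : NatLE z s) :
    essentialUnit z = essentialUnit s := by
  have h' : z = s * (z⁻¹ * z) := h
  have h1 : essentialUnit (z⁻¹ * z) = 1 := Units.ext ((cls_eq_one_iff (idem_dom z.1)).2 z.2.1)
  rw [h', essentialUnit_mul, h1, mul_one]

theorem essentialUnit_eq_iff (hM : LenzIdemPure M) {s t : EssentialPart M} :
    essentialUnit s = essentialUnit t ↔ sigmaCon (EssentialPart M) s t := by
  constructor
  · intro h
    have h1 : cls (s⁻¹ * t).1 = 1 := by
      have h2 : cls s.1 = cls t.1 := congrArg Units.val h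
      calc cls (s⁻¹ * t).1 = cls s.1⁻¹ * cls t.1 := rfl
        _ = cls s.1⁻¹ * cls s.1 := by rw [h2]
        _ = 1 := (essentialUnit s).inv_val
    have hi : IsIdempotentElem (s⁻¹ * t).1 := hM _ (by rw [h1]; exact mul_one 1)
    have hi' : (s⁻¹ * t) * (s⁻¹ * t) = s⁻¹ * t := Subtype.ext hi
    exact ⟨s * (s⁻¹ * t), natLE_of_mul hi' rfl,
      natLE_of_mul_left (idem_ran s) (mul_assoc s s⁻¹ t).symm⟩
  · rintro ⟨z, h1, h2⟩
    rw [← essentialUnit_eq_of_natLE h1, essentialUnit_eq_of_natLE h2]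

/-- If the Lenz congruence is idempotent-pure, the units of `M / ≡` are the essential elements
modulo `σ`. -/
noncomputable def unitsEquiv (hM : LenzIdemPure M) :
    SigmaQuotient (EssentialPart M) ≃* (LenzQuotient M)ˣ :=
  MulEquiv.ofBijective
    (⟨Quotient.lift essentialUnit fun _ _ h => (essentialUnit_eq_iff hM).2 h,
      fun x y => Con.induction_on₂ x y fun s t => essentialUnit_mul s t⟩ :
        SigmaQuotient (EssentialPart M) →ₙ* (LenzQuotient M)ˣ)
    ⟨fun x y => Con.induction_on₂ x y fun _ _ h =>
        (Con.eq (sigmaCon (EssentialPart M))).2 ((essentialUnit_eq_iff hM).1 h),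
      fun u => by
        obtain ⟨s, hs⟩ := essentialUnit_surjective u
        exact ⟨(s : (sigmaCon (EssentialPart M)).Quotient), hs⟩⟩

end LenzQuotient

/-! ### Bijective morphisms as partial maps -/

section Morphisms

variable {C : Type u} [Category.{v} C]

theorem IsFGIdeal.union {A B : Set (Arr C)} (hA : IsFGIdeal A) (hB : IsFGIdeal B) :
    IsFGIdeal (A ∪ B) := by
  have h := IsFGIdeal.iUnion (Set.toFinite (Set.univ : Set Bool))
    (A := fun i => cond i A B) (fun i _ => by cases i <;> assumption)
  rw [Set.union_eq_iUnion]
  simpa using h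

theorem IsFGIdeal.mul_mem {A : Set (Arr C)} (hA : IsFGIdeal A) {r s t : Arr C} (hr : r ∈ A)
    (h : IsProd r s t) : t ∈ A := by
  obtain ⟨X, -, rfl⟩ := hA
  exact genIdeal_mul hr h

theorem isFGIdeal_singleton (a : Arr C) : IsFGIdeal (genIdeal {a}) :=
  ⟨{a}, Set.finite_singleton a, rfl⟩

theorem mem_genIdeal_singleton {a c : Arr C} : c ∈ genIdeal {a} ↔ ∃ s, IsProd a s c := by
  simp [genIdeal]

theorem Option.or_eq_some_iff_of_agree {α : Type*} {x y : Option α}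
    (h : ∀ a b, x = some a → y = some b → a = b) (a : α) :
    x.or y = some a ↔ x = some a ∨ y = some a := by
  cases x with
  | none => simp
  | some c =>
    simp only [Option.some_or, Option.some.injEq]
    exact ⟨Or.inl, fun h' => h'.elim id (h c a rfl)⟩

namespace BijMor

open Classical in
/-- The identity on a finitely generated right ideal. -/
noncomputable def idOn (A : Set (Arr C)) (hA : IsFGIdeal A) : BijMor C where
  toPEquiv := PEquiv.ofSet A
  domain_fg := by simpa [PEquiv.ofSet] using hA
  range_fg := by simpa [PEquiv.ofSet] using hA
  map_mul r r' s t h hp := by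
    obtain ⟨rfl, hr⟩ := (PEquiv.ofSet_eq_some_iff).1 h
    exact ⟨t, PEquiv.ofSet_eq_some_iff.2 ⟨rfl, hA.mul_mem hr hp⟩, hp⟩

theorem idOn_apply {A : Set (Arr C)} {hA : IsFGIdeal A} {a b : Arr C} :
    (idOn A hA).toPEquiv a = some b ↔ a = b ∧ a ∈ A := by
  classical
  exact (PEquiv.ofSet_eq_some_iff).trans
    ⟨fun ⟨h1, h2⟩ => ⟨h1.symm, by simpa [← h1] using h2⟩, fun ⟨h1, h2⟩ => ⟨h1.symm, h1 ▸ h2⟩⟩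

/-- The union of two bijective morphisms that agree on the intersection of their domains and whose
inverses agree on the intersection of their ranges. -/
def union (θ φ : BijMor C)
    (h1 : ∀ a b b', θ.toPEquiv a = some b → φ.toPEquiv a = some b' → b = b')
    (h2 : ∀ b a a', θ.toPEquiv.symm b = some a → φ.toPEquiv.symm b = some a' → a = a') :
    BijMor C :=
  let f : Arr C ≃. Arr C :=
    { toFun := fun a => (θ.toPEquiv a).or (φ.toPEquiv a)
      invFun := fun b => (θ.toPEquiv.symm b).or (φ.toPEquiv.symm b)
      inv := fun a b => by
        simp only [Option.or_eq_some_iff_of_agree (h1 a),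
          Option.or_eq_some_iff_of_agree (h2 b), symm_iff] }
  have hf : ∀ a b, f a = some b ↔ θ.toPEquiv a = some b ∨ φ.toPEquiv a = some b :=
    fun a b => Option.or_eq_some_iff_of_agree (h1 a) b
  { toPEquiv := f
    domain_fg := by
      simp only [hf, exists_or]
      exact θ.domain_fg.union φ.domain_fg
    range_fg := by
      simp only [hf, exists_or]
      exact θ.range_fg.union φ.range_fg
    map_mul := fun r r' s t h hp => by
      simp only [hf] at h ⊢
      rcases h with h | h
      · obtain ⟨t', h3, h4⟩ := θ.map_mul _ _ _ _ h hp
        exact ⟨t', Or.inl h3, h4⟩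
      · obtain ⟨t', h3, h4⟩ := φ.map_mul _ _ _ _ h hp
        exact ⟨t', Or.inr h3, h4⟩ }

theorem union_apply {θ φ : BijMor C}
    (h1 : ∀ a b b', θ.toPEquiv a = some b → φ.toPEquiv a = some b' → b = b')
    (h2 : ∀ b a a', θ.toPEquiv.symm b = some a → φ.toPEquiv.symm b = some a' → a = a')
    (a b : Arr C) : (θ.union φ h1 h2).toPEquiv a = some b ↔
      θ.toPEquiv a = some b ∨ φ.toPEquiv a = some b :=
  Option.or_eq_some_iff_of_agree (h1 a) b

theorem ne_zero_iff {θ : BijMor C} : θ ≠ 0 ↔ ∃ a b, θ.toPEquiv a = some b := by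
  rw [← not_iff_not]
  push Not
  constructor
  · rintro rfl a b h
    exact Option.some_ne_none b h.symm
  · intro h
    refine ext_iff' fun a b => ⟨fun hab => absurd hab (h a b), fun hab => ?_⟩
    exact absurd hab.symm (Option.some_ne_none b)

variable [FinitelyAligned C]

theorem inv_mul_apply {θ : BijMor C} {a b : Arr C} : (θ⁻¹ * θ).toPEquiv a = some b ↔
    a = b ∧ ∃ c, θ.toPEquiv a = some c := by
  have h := mul_inv_apply (θ := θ⁻¹) (a := a) (b := b)
  rw [inv_inv'] at h
  simpa only [inv_apply] using h

theorem natLE_iff {θ φ : BijMor C} :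
    NatLE θ φ ↔ ∀ a b, θ.toPEquiv a = some b → φ.toPEquiv a = some b := by
  constructor
  · intro h a b hab
    rw [show θ = φ * (θ⁻¹ * θ) from h, mul_apply] at hab
    obtain ⟨c, h1, h2⟩ := hab
    rw [inv_mul_apply] at h1
    rwa [h1.1]
  · intro h
    refine ext_iff' fun a b => ?_
    simp only [mul_apply (θ := φ), inv_mul_apply]
    constructor
    · intro hab
      exact ⟨a, ⟨rfl, b, hab⟩, h a b hab⟩
    · rintro ⟨_, ⟨rfl, c, hc⟩, hb⟩
      rw [hc, ← h a c hc, hb]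

theorem isIdempotentElem_iff {θ : BijMor C} :
    IsIdempotentElem θ ↔ ∀ a b, θ.toPEquiv a = some b → a = b := by
  constructor
  · intro h a b hab
    have h1 : θ = θ⁻¹ * θ := by rw [idem_inv h, h.eq]
    rw [h1, inv_mul_apply] at hab
    exact hab.1
  · intro h
    refine ext_iff' fun a b => ?_
    rw [mul_apply]
    constructor
    · rintro ⟨c, h1, h2⟩
      rwa [h a c h1]
    · intro hab
      have := h a b hab
      subst this
      exact ⟨a, hab, hab⟩

theorem isIdempotentElem_idOn {A : Set (Arr C)} (hA : IsFGIdeal A) :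
    IsIdempotentElem (idOn A hA) :=
  isIdempotentElem_iff.2 fun _ _ h => (idOn_apply.1 h).1

theorem Compatible.eq_of_apply {θ φ : BijMor C} (h : Compatible θ φ) {a b b' : Arr C}
    (h1 : θ.toPEquiv a = some b) (h2 : φ.toPEquiv a = some b') : b = b' :=
  (isIdempotentElem_iff.1 h.2 b' b (mul_apply.2 ⟨a, inv_apply.2 h2, h1⟩)).symm

theorem Compatible.eq_of_apply_eq {θ φ : BijMor C} (h : Compatible θ φ) {a a' b : Arr C}
    (h1 : θ.toPEquiv a = some b) (h2 : φ.toPEquiv a' = some b) : a = a' :=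
  (isIdempotentElem_iff.1 h.1 a' a (mul_apply.2 ⟨b, h2, inv_apply.2 h1⟩)).symm

/-! ### The Lenz congruence on bijective morphisms -/

variable [Finite C]

/-- Nonzero restrictions may be tested on principal right ideals, where a morphism is determined by
its value at the generator. -/
theorem lenzBelow_iff {θ φ : BijMor C} : LenzBelow θ φ ↔ ∀ r r', θ.toPEquiv r = some r' →
    ∃ s t t', IsProd r s t ∧ θ.toPEquiv t = some t' ∧ φ.toPEquiv t = some t' := by
  constructor
  · intro h r r' hr
    have hle : NatLE (θ * idOn _ (isFGIdeal_singleton r)) θ :=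
      natLE_of_mul (isIdempotentElem_idOn _) rfl
    obtain ⟨z, hz, hzx, hzφ⟩ := h _ (ne_zero_iff.2
      ⟨r, r', mul_apply.2 ⟨r, idOn_apply.2 ⟨rfl, subset_genIdeal {r} (Set.mem_singleton r)⟩, hr⟩⟩) hle
    obtain ⟨t, t', ht⟩ := ne_zero_iff.1 hz
    obtain ⟨_, h1, h2⟩ := mul_apply.1 (natLE_iff.1 hzx t t' ht)
    obtain ⟨rfl, h3⟩ := idOn_apply.1 h1
    obtain ⟨s, hs⟩ := mem_genIdeal_singleton.1 h3
    exact ⟨s, t, t', hs, h2, natLE_iff.1 hzφ t t' ht⟩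
  · intro h x hx hxθ
    obtain ⟨r, r', hr⟩ := ne_zero_iff.1 hx
    obtain ⟨s, t, t', hs, h1, h2⟩ := h r r' (natLE_iff.1 hxθ r r' hr)
    obtain ⟨t'', h3, -⟩ := x.map_mul _ _ _ _ hr hs
    have h4 := natLE_iff.1 hxθ t t'' h3
    rw [h1, Option.some.injEq] at h4
    subst h4
    refine ⟨x * idOn _ (isFGIdeal_singleton t), ne_zero_iff.2
      ⟨t, t', mul_apply.2 ⟨t, idOn_apply.2 ⟨rfl, subset_genIdeal {t} (Set.mem_singleton t)⟩, h3⟩⟩,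
      natLE_of_mul (isIdempotentElem_idOn _) rfl, natLE_iff.2 fun a b hab => ?_⟩
    obtain ⟨_, h5, h6⟩ := mul_apply.1 hab
    obtain ⟨rfl, h7⟩ := idOn_apply.1 h5
    obtain ⟨q, hq⟩ := mem_genIdeal_singleton.1 h7
    obtain ⟨b1, h8, h9⟩ := x.map_mul _ _ _ _ h3 hq
    obtain ⟨b2, h10, h11⟩ := φ.map_mul _ _ _ _ h2 hq
    rw [h6, Option.some.injEq] at h8
    rw [h10, h8, h9.eq h11]

open LenzQuotient

/-- The class of a union of partial bijections is the join of their classes. -/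
theorem isJoin_cls {θ φ ψ : BijMor C} (h : ∀ a b, ψ.toPEquiv a = some b ↔
    θ.toPEquiv a = some b ∨ φ.toPEquiv a = some b) : IsJoin (cls θ) (cls φ) (cls ψ) := by
  refine ⟨natLE_cls.2 (NatLE.lenzBelow (natLE_iff.2 fun a b hab => (h a b).2 (Or.inl hab))),
    natLE_cls.2 (NatLE.lenzBelow (natLE_iff.2 fun a b hab => (h a b).2 (Or.inr hab))),
    fun d hθ hφ => ?_⟩
  obtain ⟨d, rfl⟩ := cls_surjective d
  rw [natLE_cls, lenzBelow_iff] at hθ hφ ⊢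
  intro r r' hr
  rcases (h r r').1 hr with hr | hr
  · obtain ⟨s, t, t', h1, h2, h3⟩ := hθ r r' hr
    exact ⟨s, t, t', h1, (h t t').2 (Or.inl h2), h3⟩
  · obtain ⟨s, t, t', h1, h2, h3⟩ := hφ r r' hr
    exact ⟨s, t, t', h1, (h t t').2 (Or.inr h2), h3⟩

/-- Compatible classes have compatible representatives, and these have a union. -/
theorem exists_union (hC : LenzIdemPure (BijMor C)) {θ φ : BijMor C}
    (h : Compatible (cls θ) (cls φ)) : ∃ ψ : BijMor C, ∀ a b,
      ψ.toPEquiv a = some b ↔ θ.toPEquiv a = some b ∨ φ.toPEquiv a = some b := by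
  have h' : Compatible θ φ := ⟨hC _ h.1, hC _ h.2⟩
  exact ⟨θ.union φ (fun _ _ _ => Compatible.eq_of_apply h')
    (fun _ _ _ h1 h2 => Compatible.eq_of_apply_eq h' (θ.symm_iff.1 h1) (φ.symm_iff.1 h2)),
    union_apply _ _⟩

theorem isDistributive_lenzQuotient (hC : LenzIdemPure (BijMor C)) :
    IsDistributive (LenzQuotient (BijMor C)) where
  exists_join a b hab := by
    obtain ⟨θ, rfl⟩ := cls_surjective a
    obtain ⟨φ, rfl⟩ := cls_surjective b
    obtain ⟨ψ, h⟩ := exists_union hC hab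
    exact ⟨cls ψ, isJoin_cls h⟩
  mul_join s a b c hab hc := by
    obtain ⟨θ, rfl⟩ := cls_surjective a
    obtain ⟨φ, rfl⟩ := cls_surjective b
    obtain ⟨χ, rfl⟩ := cls_surjective s
    obtain ⟨ψ, h⟩ := exists_union hC hab
    rw [IsJoin.unique hc (isJoin_cls h), ← cls_mul, ← cls_mul, ← cls_mul]
    refine isJoin_cls fun x y => ?_
    simp only [mul_apply, h, or_and_right, exists_or]
  join_mul s a b c hab hc := by
    obtain ⟨θ, rfl⟩ := cls_surjective a
    obtain ⟨φ, rfl⟩ := cls_surjective b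
    obtain ⟨χ, rfl⟩ := cls_surjective s
    obtain ⟨ψ, h⟩ := exists_union hC hab
    rw [IsJoin.unique hc (isJoin_cls h), ← cls_mul, ← cls_mul, ← cls_mul]
    refine isJoin_cls fun x y => ?_
    simp only [mul_apply, h, and_or_left, exists_or]

end BijMor

end Morphisms

/-! ### Higher rank graphs -/

section Graphs

variable {C : Type u} [Category.{v} C] [HigherRankGraph C]

open HigherRankGraph

/-- Membership in an ideal generated in degrees at most `m` is decided by the left factor of
degree `m`. -/
theorem mem_genIdeal_of_isProd {X : Set (Arr C)} {b s c : Arr C}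
    (hX : ∀ x ∈ X, HigherRankGraph.degree x.hom ≤ HigherRankGraph.degree b.hom)
    (h : IsProd b s c) (hc : c ∈ genIdeal X) : b ∈ genIdeal X := by
  obtain ⟨x, hx, t, ht⟩ := hc
  obtain ⟨p, q, hpq, hp, -⟩ := exists_factor (add_tsub_cancel_of_le (hX x hx)).symm
  obtain ⟨r, -, hr⟩ := hpq.assoc h
  cases hr.left_unique ht hp
  exact ⟨_, hx, q, hpq⟩

/-- Without sources, every arrow `c` has a multiple with a left factor of degree `m`. -/
theorem exists_multiple_factor [NoSources C] (c : Arr C) (m : Fin (rank C) → ℕ) :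
    ∃ s b t d : Arr C, IsProd c s d ∧ IsProd b t d ∧ HigherRankGraph.degree b.hom = m := by
  obtain ⟨x, s, hs⟩ := NoSources.exists_arrow c.dom m
  obtain ⟨d, hd⟩ := IsProd.exists (a := c) (b := ⟨s⟩) rfl
  have hm : m ≤ HigherRankGraph.degree d.hom := by
    rw [hd.degree, hs]
    exact le_add_self
  obtain ⟨b, t, hbt, hb, -⟩ := exists_factor (add_tsub_cancel_of_le hm).symm
  exact ⟨_, b, t, d, hd, hbt, hb⟩

theorem finite_setOf_degree_eq [Finite C] [RowFinite C] (m : Fin (rank C) → ℕ) :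
    {a : Arr C | HigherRankGraph.degree a.hom = m}.Finite := by
  refine (Set.finite_iUnion fun e : C => (RowFinite.finite_arrows e m).image
    (fun p : Σ x : C, (x ⟶ e) => (⟨p.2⟩ : Arr C))).subset ?_
  rintro ⟨a⟩ ha
  exact Set.mem_iUnion.2 ⟨_, ⟨_, a⟩, ha, rfl⟩

namespace BijMor

open LenzQuotient

variable [Finite C] [RowFinite C]

variable (C) in
theorem lenzIdemPure : LenzIdemPure (BijMor C) := by
  intro θ hθ
  have h1 : cls θ = cls (θ⁻¹ * θ) := by rw [cls_mul, cls_inv, idem_inv hθ, hθ.eq]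
  refine isIdempotentElem_iff.2 fun r r' hr => ?_
  obtain ⟨s, t, t', hs, ht, ht'⟩ := lenzBelow_iff.1 (cls_eq_cls.1 h1).1 r r' hr
  obtain ⟨rfl, -⟩ := inv_mul_apply.1 ht'
  obtain ⟨t', h2, h3⟩ := θ.map_mul _ _ _ _ hr hs
  cases ht.symm.trans h2
  -- `rs = r's`, so that `r` and `r'` have the same degree.
  exact hs.left_unique h3 (add_right_cancel (hs.degree.symm.trans h3.degree))

theorem exists_compl [NoSources C] {e : BooleanQuotient C} (he : IsIdempotentElem e) :
    ∃ f : BooleanQuotient C, IsIdempotentElem f ∧ e * f = 0 ∧ IsJoin e f 1 := by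
  obtain ⟨ε, rfl⟩ := cls_surjective e
  have hε := isIdempotentElem_iff.1 (lenzIdemPure C ε he)
  obtain ⟨X, hX, hdom⟩ := ε.domain_fg
  have hmem : ∀ a b, ε.toPEquiv a = some b ↔ a = b ∧ a ∈ genIdeal X := fun a b => by
    rw [← hdom]
    constructor
    · intro h
      exact ⟨hε a b h, b, h⟩
    · rintro ⟨rfl, b, h⟩
      rwa [← hε a b h] at h
  obtain ⟨m, hm⟩ := (hX.image fun x : Arr C => HigherRankGraph.degree x.hom).bddAbove
  have hm' : ∀ x ∈ X, HigherRankGraph.degree x.hom ≤ m := fun x hx => hm ⟨x, hx, rfl⟩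
  let Y : Set (Arr C) := {b | HigherRankGraph.degree b.hom = m ∧ b ∉ genIdeal X}
  have hY : IsFGIdeal (genIdeal Y) :=
    ⟨Y, (finite_setOf_degree_eq m).subset fun b hb => hb.1, rfl⟩
  have hXfg : IsFGIdeal (genIdeal X) := ⟨X, hX, rfl⟩
  have hdisj : ∀ c, c ∈ genIdeal X → c ∉ genIdeal Y := by
    rintro c hc ⟨b, ⟨hb, hbX⟩, s, hs⟩
    exact hbX (mem_genIdeal_of_isProd (by rwa [hb]) hs hc)
  refine ⟨cls (idOn _ hY), congrArg cls (isIdempotentElem_idOn hY), congrArg cls ?_, ?_⟩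
  · by_contra h
    obtain ⟨a, b, hab⟩ := ne_zero_iff.1 h
    obtain ⟨c, h1, h2⟩ := mul_apply.1 hab
    obtain ⟨rfl, h3⟩ := idOn_apply.1 h1
    exact hdisj a ((hmem a b).1 h2).2 h3
  · have hcover : cls (idOn _ (hXfg.union hY)) = 1 := by
      rw [← cls_one, cls_eq_cls]
      refine ⟨(natLE_one_iff.2 (isIdempotentElem_idOn _)).lenzBelow, lenzBelow_iff.2 ?_⟩
      intro r r' _
      obtain ⟨s, b, t, d, h1, h2, hb⟩ := exists_multiple_factor r m
      refine ⟨s, d, d, h1, rfl, idOn_apply.2 ⟨rfl, ?_⟩⟩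
      by_cases hbX : b ∈ genIdeal X
      · exact Or.inl (genIdeal_mul hbX h2)
      · exact Or.inr ⟨b, ⟨hb, hbX⟩, t, h2⟩
    rw [← hcover]
    refine isJoin_cls fun a b => ?_
    rw [hmem, idOn_apply, idOn_apply, ← and_or_left]
    rfl

end BijMor

end Graphs

theorem mainTheorem2 (C : Type u) [Category.{v} C] [HigherRankGraph C] [Nonempty C] [Finite C]
    [NoSources C] [RowFinite C] :
    IsBooleanInverseMonoid (BooleanQuotient C) ∧
      Nonempty ((BooleanQuotient C)ˣ ≃* CategoryGroup C) :=
  ⟨isBooleanInverseMonoid_of_compl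
      (BijMor.isDistributive_lenzQuotient (BijMor.lenzIdemPure C))
      fun _ => BijMor.exists_compl,
    ⟨(LenzQuotient.unitsEquiv (BijMor.lenzIdemPure C)).symm⟩⟩
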